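/- Let $\mathbb F$ be a finite field and let $n,k,\delta$ be integers with $0<k<n$, $\delta\ge 0$ and $k\nmid\delta$. Put $m=\lfloor \delta/k\rfloor+1$ and $L=\lfloor \delta/(n-k)\rfloor+m-1$. Let $G(z)=\sum_{i=0}^{m}G_iz^i\in\mathbb F[z]^{k\times n}$ with $G_i\in\mathbb F^{k\times n}$, and put $G_i=0$ for $i>m$. Suppose the following. (a) $G(z)$ is row-reduced: its rows are linearly independent over $\mathbb F[z]$, and the sum of its row degrees is minimal among all $k\times n$ matrices whose rows form a basis of the $\mathbb F[z]$-row module of $G(z)$. (b) Let $G_L^c\in\mathbb F^{(L+1)k\times(L+1)n}$ be the block upper triangular matrix whose block in position $(p,q)$, $0\le p,q\le L$, is $G_{q-p}$ if $p\le q$ and $0$ otherwise. Every full-size minor of $G_L^c$ that is not trivially zero is nonzero, that is, every minor formed by columns $1\le t_1<\dots<t_{(L+1)k}\le (L+1)n$ with $t_{sk+1}>sn$ for $s=1,\dots,L$ is nonzero. (c) There are $r\in\mathbb N_0$ and $S\subseteq\{1,\dots,k\}$ with $|S|=\delta-k\lfloor\delta/k\rfloor$ such that the rows of $G_m$ with index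 outside $S$ are zero and the matrix $$\bar G=\begin{bmatrix}G_0\\ \vdots&\ddots\\ G_m&&G_0\\ &\ddots&\vdots\\ &&\tilde G_m\end{bmatrix}\in\mathbb F^{(k(r+m)+|S|)\times n(r+1)}$$ has full row rank. Here $\tilde G_m$ consists of the rows of $G_m$ with index in $S$; that is, $\bar G$ has block columns $q=0,\dots,r$ and block rows $p=0,\dots,r+m$, with block $G_{p-q}$ if $0\le p-q\le m$ and $0$ otherwise, where only the rows with index in $S$ are kept in the last block row $p=r+m$. Then the rows of $G(z)$ form a basis of a noncatastrophic $(n,k,\delta)$ MDP convolutional code $\mathcal C$. That is: $\mathcal C$ is a submodule of $\mathbb F[z]^n$ of rank $k$; the highest degree of the $k\times k$ minors of a generator matrix (a matrix whose rows form a basis of $\mathcal C$) is $\delta$; $\mathcal C$ has a left prime generator matrix, i.e. one for which the factor $M(z)$ in every factorization $M(z)G'(z)$ with $M(z)\in\mathbb F[z]^{k\times k}$ and $G'(z)\in\mathbb F[z]^{k\times n}$ is unimodular; and for all $0\le j\le \lfloor\delta/k\rfloor+\lfloor\delta/(n-k)\rfloor$ the $j$-th column distance $$d_j^c(\mathcal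 C)=\min\Big\{\sum_{i=0}^{j}\mathrm{wt}(v_i)\ :\ v(z)=\sum_i v_iz^i\in\mathcal C,\ v_0\neq 0\Big\}$$ ($\mathrm{wt}$ being the Hamming weight on $\mathbb F^n$) equals $(n-k)(j+1)+1$. -/

import Mathlib

open Polynomial

namespace ConvCode

variable {F : Type*} [Field F] {n k : ℕ}

/-- `G` is a generator matrix of the submodule `C` of `F[z]^n`: its rows form a basis of `C`. -/
def IsGeneratorMatrix (C : Submodule F[X] (Fin n → F[X])) (G : Matrix (Fin k) (Fin n) F[X]) :
    Prop :=
  LinearIndependent F[X] G.row ∧ Submodule.span F[X] (Set.range G.row) = C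

/-- The `i`-th row degree: the largest degree among the entries of the `i`-th row. -/
def rowDegree (G : Matrix (Fin k) (Fin n) F[X]) (i : Fin k) : ℕ :=
  Finset.univ.sup fun j => (G i j).natDegree

/-- `G` is row-reduced: it has linearly independent rows, and the sum of its row degrees is minimal
among all generator matrices of the code that it generates. -/
def IsRowReduced (G : Matrix (Fin k) (Fin n) F[X]) : Prop :=
  LinearIndependent F[X] G.row ∧
    ∀ G' : Matrix (Fin k) (Fin n) F[X],
      IsGeneratorMatrix (Submodule.span F[X] (Set.range G.row)) G' →
        ∑ i, rowDegree G i ≤ ∑ i, rowDegree G' i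

/-- `C` is an `(n, k, δ)` convolutional code: a submodule of `F[z]^n` of rank `k`, such that `δ` is
the highest degree of the (nonzero) `k × k` minors of a generator matrix. -/
def IsConvolutionalCode (C : Submodule F[X] (Fin n → F[X])) (k δ : ℕ) : Prop :=
  Module.finrank F[X] C = k ∧
    ∃ G : Matrix (Fin k) (Fin n) F[X], IsGeneratorMatrix C G ∧
      IsGreatest {d : ℕ | ∃ t : Fin k → Fin n, StrictMono t ∧
        (G.submatrix id t).det ≠ 0 ∧ (G.submatrix id t).det.natDegree = d} δ

/-- `G` is left prime: every square left factor of `G` is unimodular. -/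
def IsLeftPrime (G : Matrix (Fin k) (Fin n) F[X]) : Prop :=
  ∀ (M : Matrix (Fin k) (Fin k) F[X]) (G' : Matrix (Fin k) (Fin n) F[X]), G = M * G' → IsUnit M

/-- The code `C` of rank `k` is noncatastrophic: it admits a left prime generator matrix. -/
def IsNoncatastrophic (C : Submodule F[X] (Fin n → F[X])) (k : ℕ) : Prop :=
  ∃ G : Matrix (Fin k) (Fin n) F[X], IsGeneratorMatrix C G ∧ IsLeftPrime G

open Classical in
/-- The weight of the truncation `v_0 + v_1 z + ⋯ + v_j z^j` of `v(z)`, i.e. the sum of the Hamming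
weights of `v_0, …, v_j`. -/
noncomputable def truncWeight (v : Fin n → F[X]) (j : ℕ) : ℕ :=
  ∑ i ∈ Finset.range (j + 1), hammingNorm fun a => (v a).coeff i

/-- The `j`-th column distance: the minimal weight of `v_0 + ⋯ + v_j z^j` over the codewords `v(z)`
with `v_0 ≠ 0`. -/
noncomputable def columnDistance (C : Submodule F[X] (Fin n → F[X])) (j : ℕ) : ℕ :=
  sInf {w : ℕ | ∃ v ∈ C, (fun a => (v a).coeff 0) ≠ 0 ∧ truncWeight v j = w}

/-- The MDP property of an `(n, k, δ)` code: its column distances meet the bound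
`d_j ≤ (n - k)(j + 1) + 1` with equality for all `j = 0, …, L = ⌊δ/k⌋ + ⌊δ/(n-k)⌋`. -/
def IsMDP (C : Submodule F[X] (Fin n → F[X])) (k δ : ℕ) : Prop :=
  ∀ j ≤ δ / k + δ / (n - k), columnDistance C j = (n - k) * (j + 1) + 1

/-- The `j`-th truncated sliding generator matrix `G_j^c`, the block upper triangular Toeplitz
matrix whose block in block row `p` and block column `q` is `G_{q-p}` if `p ≤ q`, and zero
otherwise. -/
noncomputable def slidingGenerator (G : Matrix (Fin k) (Fin n) F[X]) (j : ℕ) :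
    Matrix (Fin ((j + 1) * k)) (Fin ((j + 1) * n)) F :=
  Matrix.of fun a b =>
    if a.divNat ≤ b.divNat then
      (G a.modNat b.modNat).coeff ((b.divNat : ℕ) - (a.divNat : ℕ))
    else 0

/-- All full-size minors of `G_j^c` that are not trivially zero are nonzero: these are the minors
formed by columns `t_1 < ⋯ < t_{(j+1)k}` with `t_{sk+1} > sn` for `s = 1, …, j`. Here rows and
columns are numbered from `0`, so that the condition becomes `t (s * k) ≥ s * n`. -/
def MinorCriterion (G : Matrix (Fin k) (Fin n) F[X]) (j : ℕ) : Prop :=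
  ∀ t : Fin ((j + 1) * k) → Fin ((j + 1) * n), StrictMono t →
    (∀ (s : ℕ) (i : Fin ((j + 1) * k)), 1 ≤ s → s ≤ j → (i : ℕ) = s * k → s * n ≤ (t i : ℕ)) →
      ((slidingGenerator G j).submatrix id t).det ≠ 0

/-- The matrix with block columns `0, …, r` and block rows `0, …, r + m`, whose block in block row
`p` and block column `q` is `G_{p-q}` if `0 ≤ p - q ≤ m` and zero otherwise, where only
the rows with index in `S` are kept in the last block row `p = r + m`. -/
noncomputable def slidingBar (G : Matrix (Fin k) (Fin n) F[X]) (m r : ℕ) (S : Finset (Fin k)) :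
    Matrix {p : Fin (r + m + 1) × Fin k // (p.1 : ℕ) < r + m ∨ p.2 ∈ S} (Fin (r + 1) × Fin n) F :=
  Matrix.of fun p q =>
    if (q.1 : ℕ) ≤ (p.1.1 : ℕ) ∧ (p.1.1 : ℕ) ≤ (q.1 : ℕ) + m then
      (G p.1.2 q.2).coeff ((p.1.1 : ℕ) - (q.1 : ℕ))
    else 0

end ConvCode

/-!
Let `u` be a message and `v = uG` its codeword. Each zero among the first `(j + 1)n` coefficients of
`v` is a column of `G_j^c` annihilated by the coefficient vector of `u`. At the first `j` for which
`v` has weight at most `(n - k)(j + 1)` up to degree `j`, these zeros contain an admissible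
selection of `(j + 1)k` columns, so that the minor criterion forces `u_0 = 0`. This bounds the
column distances from below. Conversely, some `k × k` minor of `G` has nonzero constant term, so it
is invertible modulo `z^(j+1)`, and `u` can be chosen such that `uG` is a unit vector modulo
`z^(j+1)` in those `k` columns.

Full row rank of `slidingBar` gives the other two properties. Its rows include the leading row
coefficients of `G` for the row degrees `m` on `S` and `m - 1` off `S`, whose sum is `δ`, so some
minor attains the degree `δ`. If a left factor of `G` were not unimodular, its determinant would
have a root `λ` in the algebraic closure, so `w G(λ) = 0` for some `w ≠ 0`, and the vectors `λ^p w`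
would form a linear relation between the rows of `slidingBar`.
-/

namespace ConvCode

open scoped Matrix

section PolynomialMatrices

variable {R ι κ : Type*} [CommRing R]

theorem coeff_prod_sum_of_natDegree_le (s : Finset κ) (f : κ → R[X]) (d : κ → ℕ)
    (h : ∀ i ∈ s, (f i).natDegree ≤ d i) :
    (∏ i ∈ s, f i).coeff (∑ i ∈ s, d i) = ∏ i ∈ s, (f i).coeff (d i) := by
  classical
  induction s using Finset.induction_on with
  | empty => simp
  | insert a s ha ih =>
    have hs : ∀ i ∈ s, (f i).natDegree ≤ d i := fun i hi => h i (Finset.mem_insert_of_mem hi)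
    rw [Finset.prod_insert ha, Finset.sum_insert ha, Finset.prod_insert ha, ← ih hs]
    exact coeff_mul_add_eq_of_natDegree_le (h a (Finset.mem_insert_self a s))
      ((natDegree_prod_le s f).trans (Finset.sum_le_sum hs))

variable [Fintype ι] [DecidableEq ι]

theorem natDegree_det_le_sum (A : Matrix ι ι R[X]) (d : ι → ℕ)
    (h : ∀ i j, (A i j).natDegree ≤ d i) : A.det.natDegree ≤ ∑ i, d i := by
  rw [← Matrix.det_transpose, Matrix.det_apply]
  refine natDegree_sum_le_of_forall_le _ _ fun σ _ => (natDegree_smul_le _ _).trans ?_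
  exact (natDegree_prod_le _ _).trans (Finset.sum_le_sum fun i _ => h i (σ i))

theorem coeff_det_sum (A : Matrix ι ι R[X]) (d : ι → ℕ) (h : ∀ i j, (A i j).natDegree ≤ d i) :
    A.det.coeff (∑ i, d i) = (Matrix.of fun i j => (A i j).coeff (d i)).det := by
  rw [← Matrix.det_transpose, ← Matrix.det_transpose (Matrix.of _), Matrix.det_apply,
    Matrix.det_apply, finsetSum_coeff]
  refine Finset.sum_congr rfl fun σ _ => ?_
  rw [coeff_smul]
  exact congrArg _ (coeff_prod_sum_of_natDegree_le _ _ _ fun i _ => h i (σ i))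

theorem exists_dvd_vecMul_sub_of_isCoprime_det {A : Matrix ι ι R} {a : R}
    (h : IsCoprime A.det a) (w : ι → R) : ∃ u : ι → R, ∀ c, a ∣ (u ᵥ* A) c - w c := by
  obtain ⟨x, y, hxy⟩ := h
  refine ⟨x • (w ᵥ* A.adjugate), fun c => ⟨-y * w c, ?_⟩⟩
  rw [Matrix.smul_vecMul, Matrix.vecMul_vecMul, Matrix.adjugate_mul, Matrix.vecMul_smul,
    Matrix.vecMul_one, Pi.smul_apply, Pi.smul_apply, smul_eq_mul, smul_eq_mul]
  linear_combination w c * hxy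

end PolynomialMatrices

section FullRowRank

variable {K : Type*} [Field K]

theorem exists_strictMono_det_submatrix_ne_zero {k n : ℕ} {N : Matrix (Fin k) (Fin n) K}
    (hN : LinearIndependent K N.row) :
    ∃ t : Fin k → Fin n, StrictMono t ∧ (N.submatrix id t).det ≠ 0 := by
  obtain ⟨κ, a, ha, hspan, hli⟩ := exists_linearIndependent' K N.col
  have : Fintype κ := @Fintype.ofFinite κ (Finite.of_injective a ha)
  have hcard : Fintype.card κ = k := by
    rw [← finrank_span_eq_card hli, hspan, ← Matrix.rank_eq_finrank_span_cols, hN.rank_matrix,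
      Fintype.card_fin]
  let e : Fin k ≃ κ := (Fintype.equivFinOfCardEq hcard).symm
  let σ := Tuple.sort (a ∘ e)
  have hmono : Monotone ((a ∘ e) ∘ σ) := Tuple.monotone_sort _
  refine ⟨(a ∘ e) ∘ σ, hmono.strictMono_of_injective
    ((ha.comp e.injective).comp σ.injective), ?_⟩
  have hcols : LinearIndependent K (N.submatrix id ((a ∘ e) ∘ σ)).col :=
    hli.comp (e ∘ σ) (e.injective.comp σ.injective)
  exact ((Matrix.isUnit_iff_isUnit_det _).1
    (Matrix.linearIndependent_cols_iff_isUnit.1 hcols)).ne_zero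

theorem linearIndependent_row_of_det_submatrix_ne_zero {R ι κ : Type*} [CommRing R] [IsDomain R]
    [Fintype ι] [DecidableEq ι] {N : Matrix ι κ R} {t : ι → κ}
    (h : (N.submatrix id t).det ≠ 0) : LinearIndependent R N.row :=
  .of_comp (LinearMap.funLeft R R t) (Matrix.linearIndependent_rows_of_det_ne_zero h)

theorem eq_zero_of_sum_smul_eq_zero {V ι κ : Type*} [AddCommGroup V] [Module K V] [Fintype ι]
    {N : Matrix ι κ K} (hN : LinearIndependent K N.row) {x : ι → V}
    (hx : ∀ j, ∑ i, N i j • x i = 0) : x = 0 := by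
  funext i
  refine (Module.forall_dual_apply_eq_zero_iff K _).1 fun φ => ?_
  refine Fintype.linearIndependent_iff.1 hN (fun i => φ (x i)) (funext fun j => ?_) i
  simpa [mul_comm] using congrArg φ (hx j)

end FullRowRank

section HammingWeight

variable {β : Type*} [Zero β] [DecidableEq β]

theorem hammingNorm_le_card_sub_add_hammingNorm_comp {ι κ : Type*} [Fintype ι] [Fintype κ]
    (x : ι → β) {t : κ → ι} (ht : Function.Injective t) :
    hammingNorm x ≤ Fintype.card ι - Fintype.card κ + hammingNorm (x ∘ t) := by
  classical
  have hsub : ({a | x a ≠ 0} : Finset ι) ⊆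
      (Finset.univ.image t)ᶜ ∪ ({c | (x ∘ t) c ≠ 0} : Finset κ).image t := by
    intro a ha
    by_cases hat : ∃ c, t c = a
    · obtain ⟨c, rfl⟩ := hat
      exact Finset.mem_union_right _ (Finset.mem_image_of_mem t (by simpa using ha))
    · exact Finset.mem_union_left _ (by simpa using hat)
  calc hammingNorm x
      ≤ (Finset.univ.image t)ᶜ.card + (({c | (x ∘ t) c ≠ 0} : Finset κ).image t).card :=
        (Finset.card_le_card hsub).trans (Finset.card_union_le _ _)
    _ = Fintype.card ι - Fintype.card κ + hammingNorm (x ∘ t) := by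
        rw [Finset.card_compl, Finset.card_image_of_injective _ ht,
          Finset.card_image_of_injective _ ht, Finset.card_univ, hammingNorm]

theorem count_eq_zero_add_hammingNorm (f : ℕ → β) (N : ℕ) :
    Nat.count (fun b => f b = 0) N + hammingNorm (fun b : Fin N => f b) = N := by
  rw [Nat.count_eq_card_filter_range, hammingNorm, Finset.card_filter, Finset.card_filter,
    Fin.sum_univ_eq_sum_range (fun b => if f b ≠ 0 then 1 else 0), ← Finset.sum_add_distrib]
  trans ∑ _b ∈ Finset.range N, 1
  · exact Finset.sum_congr rfl fun b _ => by split_ifs <;> simp_all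
  · simp

end HammingWeight

variable {F : Type*} [Field F] {n k : ℕ}

theorem mem_span_range_row_iff {G : Matrix (Fin k) (Fin n) F[X]} {v : Fin n → F[X]} :
    v ∈ Submodule.span F[X] (Set.range G.row) ↔ ∃ u, u ᵥ* G = v := by
  rw [← range_vecMulLinear]
  rfl

section CoefficientSequence

/-- The coefficient sequence `v_0, v_1, …` of `v(z)`, written as one sequence of field elements:
position `i * n + c` holds entry `c` of `v_i`. This is the numbering of the rows and columns of
`slidingGenerator`. -/
def flatCoeff [NeZero n] (v : Fin n → F[X]) (b : ℕ) : F :=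
  (v (Fin.ofNat n b)).coeff (b / n)

theorem flatCoeff_finProdFinEquiv [NeZero n] (v : Fin n → F[X]) {j : ℕ} (i : Fin j) (c : Fin n) :
    flatCoeff v (finProdFinEquiv (i, c)) = (v c).coeff i := by
  have h := finProdFinEquiv.symm_apply_apply (i, c)
  exact congrArg₂ (fun (i : Fin j) c => (v c).coeff i) (congrArg Prod.fst h) (congrArg Prod.snd h)

theorem flatCoeff_of_lt [NeZero n] (v : Fin n → F[X]) {b : ℕ} (hb : b < n) :
    flatCoeff v b = (v ⟨b, hb⟩).coeff 0 := by
  simp [flatCoeff, Fin.ofNat, Nat.mod_eq_of_lt hb, Nat.div_eq_of_lt hb]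

open Classical in
theorem truncWeight_eq_hammingNorm_flatCoeff [NeZero n] (v : Fin n → F[X]) (j : ℕ) :
    truncWeight v j = hammingNorm fun b : Fin ((j + 1) * n) => flatCoeff v b := by
  simp only [truncWeight, hammingNorm, Finset.card_filter]
  rw [← finProdFinEquiv.sum_comp, Fintype.sum_prod_type, ← Fin.sum_univ_eq_sum_range
    (fun i => ∑ a, if (v a).coeff i ≠ 0 then 1 else 0)]
  simp only [flatCoeff_finProdFinEquiv]

theorem infinite_setOf_flatCoeff_eq_zero [NeZero n] (v : Fin n → F[X]) :
    {b | flatCoeff v b = 0}.Infinite := by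
  refine Set.infinite_of_forall_exists_gt fun N => ?_
  let D := Finset.univ.sup fun c => (v c).natDegree
  have hD : ∀ c, (v c).natDegree ≤ D := fun c =>
    Finset.le_sup (f := fun c => (v c).natDegree) (Finset.mem_univ c)
  have hn := Nat.pos_of_neZero n
  refine ⟨(N + D + 1) * n, coeff_eq_zero_of_natDegree_lt ?_, by nlinarith⟩
  rw [Nat.mul_div_cancel _ hn]
  exact (hD _).trans_lt (by lia)

open Classical in
theorem count_flatCoeff_eq_zero_add_truncWeight [NeZero n] (v : Fin n → F[X]) (j : ℕ) :
    Nat.count (fun b => flatCoeff v b = 0) ((j + 1) * n) + truncWeight v j = (j + 1) * n := by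
  rw [truncWeight_eq_hammingNorm_flatCoeff]
  convert count_eq_zero_add_hammingNorm (flatCoeff v) _

theorem nth_flatCoeff_eq_zero_lt [NeZero n] (hkn : k ≤ n) {v : Fin n → F[X]} {j : ℕ}
    (hw : truncWeight v j ≤ (n - k) * (j + 1)) {i : ℕ} (hi : i < (j + 1) * k) :
    Nat.nth (fun b => flatCoeff v b = 0) i < (j + 1) * n := by
  classical
  have hcount := count_flatCoeff_eq_zero_add_truncWeight v j
  have hsplit : (n - k) * (j + 1) + (j + 1) * k = (j + 1) * n := by
    rw [mul_comm, ← mul_add, Nat.sub_add_cancel hkn]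
  exact Nat.nth_lt_of_lt_count (by lia)

theorem le_nth_flatCoeff_eq_zero [NeZero n] {v : Fin n → F[X]} {j : ℕ}
    (hw : (n - k) * (j + 1) < truncWeight v j) :
    (j + 1) * n ≤ Nat.nth (fun b => flatCoeff v b = 0) ((j + 1) * k) := by
  classical
  have hcount := count_flatCoeff_eq_zero_add_truncWeight v j
  have hsplit : (j + 1) * n ≤ (n - k) * (j + 1) + (j + 1) * k := by
    rw [mul_comm (n - k), ← mul_add]
    exact Nat.mul_le_mul_left _ (by lia)
  exact (Nat.count_le_iff_le_nth (infinite_setOf_flatCoeff_eq_zero v)).1 (by lia)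

theorem flatCoeff_vecMul_slidingGenerator [NeZero k] [NeZero n] (G : Matrix (Fin k) (Fin n) F[X])
    (j : ℕ) (u : Fin k → F[X]) :
    (fun a : Fin ((j + 1) * k) => flatCoeff u a) ᵥ* slidingGenerator G j =
      fun b : Fin ((j + 1) * n) => flatCoeff (u ᵥ* G) b := by
  ext b
  obtain ⟨⟨i, c⟩, rfl⟩ := finProdFinEquiv.surjective b
  have hentry : ∀ p a, slidingGenerator G j (finProdFinEquiv (p, a)) (finProdFinEquiv (i, c)) =
      if p ≤ i then (G a c).coeff (i - p) else 0 := fun p a => by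
    have hrow := finProdFinEquiv.symm_apply_apply (p, a)
    have hcol := finProdFinEquiv.symm_apply_apply (i, c)
    rw [finProdFinEquiv_symm_apply, Prod.mk.injEq] at hrow hcol
    rw [slidingGenerator, Matrix.of_apply, hrow.1, hrow.2, hcol.1, hcol.2]
  simp only [Matrix.vecMul, dotProduct, flatCoeff_finProdFinEquiv]
  rw [← finProdFinEquiv.sum_comp, Fintype.sum_prod_type, Finset.sum_comm, finsetSum_coeff]
  refine Finset.sum_congr rfl fun a _ => ?_
  simp only [flatCoeff_finProdFinEquiv, hentry, ← Fin.val_fin_le, mul_ite, mul_zero]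
  rw [Fin.sum_univ_eq_sum_range
      (fun p => if p ≤ (i : ℕ) then (u a).coeff p * (G a c).coeff (i - p) else 0),
    coeff_mul, Finset.Nat.sum_antidiagonal_eq_sum_range_succ_mk, ← Finset.sum_filter]
  congr 1
  ext p
  simp only [Finset.mem_filter, Finset.mem_range]
  lia

end CoefficientSequence

theorem slidingGenerator_castLE (G : Matrix (Fin k) (Fin n) F[X]) {j L : ℕ} (hjL : j ≤ L)
    (a : Fin ((j + 1) * k)) (b : Fin ((j + 1) * n)) :
    slidingGenerator G L (a.castLE (Nat.mul_le_mul_right k (Nat.succ_le_succ hjL)))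
        (b.castLE (Nat.mul_le_mul_right n (Nat.succ_le_succ hjL))) =
      slidingGenerator G j a b :=
  rfl

section ColumnSelection

/-- Continues a selection `t` of `(j + 1) * k` columns of `slidingGenerator G j` to an infinite
selection, by taking the first `k` columns of each later block: for `i = s * k + c` with `c < k` the
second branch is `s * n + c`. -/
def extendSelection {j : ℕ} (t : Fin ((j + 1) * k) → Fin ((j + 1) * n)) (i : ℕ) : ℕ :=
  if hi : i < (j + 1) * k then t ⟨i, hi⟩ else i + i / k * (n - k)

variable {j : ℕ} {t : Fin ((j + 1) * k) → Fin ((j + 1) * n)} {i : ℕ}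

theorem extendSelection_of_lt (hi : i < (j + 1) * k) : extendSelection t i = t ⟨i, hi⟩ :=
  dif_pos hi

theorem extendSelection_of_le (hi : (j + 1) * k ≤ i) :
    extendSelection t i = i + i / k * (n - k) :=
  dif_neg hi.not_gt

theorem le_extendSelection [NeZero k] (hkn : k ≤ n) {s : ℕ} (hs : j < s) (hi : s * k ≤ i) :
    s * n ≤ extendSelection t i := by
  have hdiv : s ≤ i / k := (Nat.le_div_iff_mul_le (Nat.pos_of_neZero k)).2 hi
  rw [extendSelection_of_le ((Nat.mul_le_mul_right k hs).trans hi)]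
  calc s * n = s * k + s * (n - k) := by rw [← mul_add, Nat.add_sub_cancel' hkn]
    _ ≤ i + i / k * (n - k) := by gcongr

theorem extendSelection_lt [NeZero k] (hkn : k ≤ n) {L : ℕ} (hjL : j ≤ L)
    (hi : i < (L + 1) * k) : extendSelection t i < (L + 1) * n := by
  rcases lt_or_ge i ((j + 1) * k) with hij | hij
  · rw [extendSelection_of_lt hij]
    exact (t _).2.trans_le (by gcongr)
  · have hdiv : i / k < L + 1 := (Nat.div_lt_iff_lt_mul (Nat.pos_of_neZero k)).2 hi
    rw [extendSelection_of_le hij]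
    calc i + i / k * (n - k) < (L + 1) * k + (L + 1) * (n - k) :=
          add_lt_add_of_lt_of_le hi (by gcongr)
      _ = (L + 1) * n := by rw [← mul_add, Nat.add_sub_cancel' hkn]

theorem strictMono_extendSelection [NeZero k] (hkn : k ≤ n) (ht : StrictMono t) :
    StrictMono (extendSelection t) := by
  intro i i' hii'
  rcases lt_or_ge i' ((j + 1) * k) with hi' | hi'
  · rw [extendSelection_of_lt (hii'.trans hi'), extendSelection_of_lt hi']
    exact ht hii'
  rcases lt_or_ge i ((j + 1) * k) with hi | hi
  · rw [extendSelection_of_lt hi]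
    exact (t _).2.trans_le (le_extendSelection hkn (Nat.lt_succ_self j) hi')
  · rw [extendSelection_of_le hi, extendSelection_of_le hi']
    exact add_lt_add_of_lt_of_le hii' (Nat.mul_le_mul_right _ (Nat.div_le_div_right hii'.le))

end ColumnSelection

namespace MinorCriterion

variable {G : Matrix (Fin k) (Fin n) F[X]} {j L : ℕ}

/- Every admissible minor of `G_j^c` is the upper left block of an admissible minor of `G_L^c` that
is block upper triangular, so it divides that minor. -/
theorem mono [NeZero k] (hkn : k ≤ n) (hjL : j ≤ L) (h : MinorCriterion G L) :
    MinorCriterion G j := by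
  intro t ht htj
  let T : Fin ((L + 1) * k) → Fin ((L + 1) * n) := fun i =>
    ⟨extendSelection t i, extendSelection_lt hkn hjL i.2⟩
  have hT : ((slidingGenerator G L).submatrix id T).det ≠ 0 := by
    refine h T (fun i i' hii' => strictMono_extendSelection hkn ht hii') fun s i hs _ hi => ?_
    rcases le_or_gt s j with hsj | hsj
    · have hij : (i : ℕ) < (j + 1) * k :=
        hi ▸ Nat.mul_lt_mul_of_pos_right (by lia) (Nat.pos_of_neZero k)
      exact (htj s ⟨i, hij⟩ hs hsj hi).trans_eq (extendSelection_of_lt hij).symm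
    · exact le_extendSelection hkn hsj hi.ge
  let p : Fin ((L + 1) * k) → Prop := fun i => (i : ℕ) < (j + 1) * k
  have hzero : ∀ a, ¬ p a → ∀ i, p i → (slidingGenerator G L).submatrix id T a i = 0 := by
    intro a ha i hi
    refine if_neg fun hle : (a : ℕ) / k ≤ extendSelection t i / n => ha ?_
    have hlt : extendSelection t i / n < j + 1 := Nat.div_lt_of_lt_mul <|
      (extendSelection_of_lt hi).trans_lt ((t _).2.trans_eq (mul_comm _ _))
    exact (Nat.div_lt_iff_lt_mul (Nat.pos_of_neZero k)).1 (hle.trans_lt hlt)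
  rw [Matrix.twoBlockTriangular_det _ p hzero] at hT
  let e : Fin ((j + 1) * k) ≃ {i // p i} :=
    Fin.castLEquiv (Nat.mul_le_mul_right k (Nat.succ_le_succ hjL))
  have hblock : (slidingGenerator G j).submatrix id t =
      (((slidingGenerator G L).submatrix id T).toSquareBlockProp p).submatrix e e := by
    ext a i
    have hTi : T (e i) = Fin.castLE (by gcongr) (t i) := Fin.ext (extendSelection_of_lt i.2)
    exact (slidingGenerator_castLE G hjL a (t i)).symm.trans (congrArg _ hTi.symm)
  rw [hblock, Matrix.det_submatrix_equiv_self]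
  exact left_ne_zero_of_mul hT

theorem coeff_zero_eq_zero [NeZero k] [NeZero n] (h : MinorCriterion G j) {τ : ℕ → ℕ}
    (hτ : StrictMono τ) (hlt : ∀ i < (j + 1) * k, τ i < (j + 1) * n)
    (hle : ∀ s, 1 ≤ s → s ≤ j → s * n ≤ τ (s * k)) {u : Fin k → F[X]}
    (hu : ∀ i < (j + 1) * k, flatCoeff (u ᵥ* G) (τ i) = 0) (a : Fin k) : (u a).coeff 0 = 0 := by
  let t : Fin ((j + 1) * k) → Fin ((j + 1) * n) := fun i => ⟨τ i, hlt i i.2⟩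
  have hdet := h t (fun i i' hii' => hτ hii') fun s i hs hsj hi => by
    simpa only [t, hi] using hle s hs hsj
  have hker : (fun a : Fin ((j + 1) * k) => flatCoeff u a) ᵥ*
      (slidingGenerator G j).submatrix id t = 0 := by
    ext i
    exact (congrFun (flatCoeff_vecMul_slidingGenerator G j u) (t i)).trans (hu i i.2)
  have hzero := congrFun (Matrix.eq_zero_of_vecMul_eq_zero hdet hker) (finProdFinEquiv (0, a))
  rwa [flatCoeff_finProdFinEquiv] at hzero

/- If `j` is the first index where the bound fails, then the zeros of the coefficient sequence of
`u * G` are early enough to fill `(j + 1) * k` columns and late enough for these to be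
admissible. -/
theorem lt_truncWeight [NeZero k] (hkn : k ≤ n) (h : MinorCriterion G L)
    {u : Fin k → F[X]} {a : Fin k} (hu : (u a).coeff 0 ≠ 0) (hj : j ≤ L) :
    (n - k) * (j + 1) < truncWeight (u ᵥ* G) j := by
  have : NeZero n := .of_pos ((Nat.pos_of_neZero k).trans_le hkn)
  induction j using Nat.strong_induction_on with
  | _ j ih =>
    by_contra! hw
    have hinf := infinite_setOf_flatCoeff_eq_zero (u ᵥ* G)
    refine hu ((h.mono hkn hj).coeff_zero_eq_zero (Nat.nth_strictMono hinf)
      (fun i hi => nth_flatCoeff_eq_zero_lt hkn hw hi) (fun s hs hsj => ?_)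
      (fun i _ => Nat.nth_mem_of_infinite hinf i) a)
    obtain ⟨s, rfl⟩ := Nat.exists_eq_add_of_le' hs
    exact le_nth_flatCoeff_eq_zero (ih s hsj (by lia))

theorem det_coeff_zero_ne_zero [NeZero k] (hkn : k ≤ n) (h : MinorCriterion G L) :
    (G.submatrix id (Fin.castLE hkn)).det.coeff 0 ≠ 0 := by
  have : NeZero n := .of_pos ((Nat.pos_of_neZero k).trans_le hkn)
  rw [← constantCoeff_apply, RingHom.map_det]
  intro hdet
  obtain ⟨w, hw, hw0⟩ := Matrix.exists_vecMul_eq_zero_iff.2 hdet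
  refine hw (funext fun a => ?_)
  have hC : ((C ∘ w) a).coeff 0 = 0 :=
    (h.mono hkn (Nat.zero_le L)).coeff_zero_eq_zero strictMono_id
      (fun i hi => hi.trans_le (Nat.mul_le_mul_left _ hkn)) (fun s hs hs0 => by lia)
      (fun i hi => by
        have hik : i < k := by simpa using hi
        rw [id, flatCoeff_of_lt _ (hik.trans_le hkn)]
        simpa [Matrix.vecMul, dotProduct, finsetSum_coeff] using congrFun hw0 ⟨i, hik⟩) a
  simpa using hC

end MinorCriterion

section ColumnDistance

variable {G : Matrix (Fin k) (Fin n) F[X]}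

/- Modulo `z ^ (j + 1)` the message can be chosen such that the codeword is a unit vector in the
columns `t`. -/
theorem exists_truncWeight_vecMul_le [NeZero k] {t : Fin k → Fin n} (ht : Function.Injective t)
    (hdet : (G.submatrix id t).det.coeff 0 ≠ 0) (j : ℕ) :
    ∃ u : Fin k → F[X], (fun a => ((u ᵥ* G) a).coeff 0) ≠ 0 ∧
      truncWeight (u ᵥ* G) j ≤ (n - k) * (j + 1) + 1 := by
  classical
  have hcop : IsCoprime (G.submatrix id t).det (X ^ (j + 1)) :=
    (irreducible_X.coprime_iff_not_dvd.2 (X_dvd_iff.not.2 hdet)).symm.pow_right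
  obtain ⟨u, hu⟩ := exists_dvd_vecMul_sub_of_isCoprime_det hcop (Pi.single 0 1)
  have hcoeff : ∀ i ≤ j, ∀ c, ((u ᵥ* G) (t c)).coeff i = if i = 0 ∧ c = 0 then 1 else 0 := by
    intro i hi c
    have h0 := X_pow_dvd_iff.1 (hu c) i (by lia)
    rw [coeff_sub, sub_eq_zero] at h0
    refine h0.trans ?_
    rw [Pi.single_apply]
    split_ifs <;> simp_all [coeff_one]
  refine ⟨u, fun h0 => by simpa [hcoeff] using congrFun h0 (t 0), ?_⟩
  have hweight : ∀ i ∈ Finset.range (j + 1), hammingNorm (fun a => ((u ᵥ* G) a).coeff i) ≤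
      (n - k) + if i = 0 then 1 else 0 := by
    intro i hi
    have hle := hammingNorm_le_card_sub_add_hammingNorm_comp (fun a => ((u ᵥ* G) a).coeff i) ht
    rw [Fintype.card_fin, Fintype.card_fin] at hle
    refine hle.trans (Nat.add_le_add_left ?_ _)
    rw [hammingNorm]
    simp only [Function.comp_apply, hcoeff i (Finset.mem_range_succ_iff.1 hi)]
    split_ifs with h0 <;> simp [h0, Finset.filter_eq']
  calc truncWeight (u ᵥ* G) j
      ≤ ∑ i ∈ Finset.range (j + 1), ((n - k) + if i = 0 then 1 else 0) := by
        unfold truncWeight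
        convert Finset.sum_le_sum hweight
    _ = (n - k) * (j + 1) + 1 := by
        simp [Finset.sum_add_distrib, mul_comm]

theorem MinorCriterion.columnDistance_eq [NeZero k] (hkn : k ≤ n) {j L : ℕ}
    (h : MinorCriterion G L) (hj : j ≤ L) :
    columnDistance (Submodule.span F[X] (Set.range G.row)) j = (n - k) * (j + 1) + 1 := by
  obtain ⟨u, hu, hweight⟩ := exists_truncWeight_vecMul_le (Fin.castLE_injective hkn)
    (h.det_coeff_zero_ne_zero hkn) j
  have hmem : truncWeight (u ᵥ* G) j ∈ {w : ℕ | ∃ v ∈ Submodule.span F[X] (Set.range G.row),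
      (fun a => (v a).coeff 0) ≠ 0 ∧ truncWeight v j = w} :=
    ⟨_, mem_span_range_row_iff.2 ⟨u, rfl⟩, hu, rfl⟩
  refine le_antisymm ((Nat.sInf_le hmem).trans hweight) (le_csInf ⟨_, hmem⟩ ?_)
  rintro w ⟨v, hv, hv0, rfl⟩
  obtain ⟨u, rfl⟩ := mem_span_range_row_iff.1 hv
  obtain ⟨a, ha⟩ : ∃ a, (u a).coeff 0 ≠ 0 := by
    contrapose! hv0
    funext c
    simp [Matrix.vecMul, dotProduct, finsetSum_coeff, mul_coeff_zero, hv0]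
  exact h.lt_truncWeight hkn ha hj

end ColumnDistance

section RowDegrees

/-- The row degrees prescribed by condition (c): `m` for the rows in `S`, and `m - 1` for the
others. -/
def prescribedDegree (m : ℕ) (S : Finset (Fin k)) (i : Fin k) : ℕ :=
  if i ∈ S then m else m - 1

/-- The leading row coefficient matrix of `G` with respect to bounds `d` for its row degrees: row
`i` holds the coefficients of `z ^ d i`. -/
def leadingRowCoeff (G : Matrix (Fin k) (Fin n) F[X]) (d : Fin k → ℕ) :
    Matrix (Fin k) (Fin n) F :=
  Matrix.of fun i j => (G i j).coeff (d i)

variable {G : Matrix (Fin k) (Fin n) F[X]} {m r : ℕ} {S : Finset (Fin k)}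

theorem prescribedDegree_le (m : ℕ) (S : Finset (Fin k)) (i : Fin k) :
    prescribedDegree m S i ≤ m := by
  unfold prescribedDegree
  split_ifs <;> lia

theorem sum_prescribedDegree (hm : 0 < m) (S : Finset (Fin k)) :
    ∑ i, prescribedDegree m S i = k * (m - 1) + S.card := by
  have hsplit : ∀ i, prescribedDegree m S i = (m - 1) + if i ∈ S then 1 else 0 := fun i => by
    unfold prescribedDegree
    split_ifs <;> lia
  simp [hsplit, Finset.sum_add_distrib]

theorem natDegree_le_prescribedDegree (hdeg : ∀ i j, (G i j).natDegree ≤ m)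
    (hS : ∀ i, i ∉ S → ∀ j, (G i j).coeff m = 0) (i : Fin k) (j : Fin n) :
    (G i j).natDegree ≤ prescribedDegree m S i := by
  unfold prescribedDegree
  split_ifs with hi
  · exact hdeg i j
  · exact natDegree_le_pred (hdeg i j) (hS i hi j)

theorem isGreatest_natDegree_det_submatrix {d : Fin k → ℕ} (hdeg : ∀ i j, (G i j).natDegree ≤ d i)
    (hlead : LinearIndependent F (leadingRowCoeff G d).row) :
    IsGreatest {e : ℕ | ∃ t : Fin k → Fin n, StrictMono t ∧
      (G.submatrix id t).det ≠ 0 ∧ (G.submatrix id t).det.natDegree = e} (∑ i, d i) := by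
  have hle : ∀ t : Fin k → Fin n, (G.submatrix id t).det.natDegree ≤ ∑ i, d i := fun t =>
    natDegree_det_le_sum _ d fun i j => hdeg i (t j)
  refine ⟨?_, fun e ⟨t, _, _, he⟩ => he ▸ hle t⟩
  obtain ⟨t, ht, hdet⟩ := exists_strictMono_det_submatrix_ne_zero hlead
  have hcoeff : (G.submatrix id t).det.coeff (∑ i, d i) ≠ 0 := by
    rwa [coeff_det_sum (G.submatrix id t) d fun i j => hdeg i (t j)]
  refine ⟨t, ht, fun h0 => hcoeff (by rw [h0, coeff_zero]), (hle t).antisymm ?_⟩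
  exact le_natDegree_of_ne_zero hcoeff

theorem slidingBar_apply (hdeg : ∀ i j, (G i j).natDegree ≤ m)
    (p : {p : Fin (r + m + 1) × Fin k // (p.1 : ℕ) < r + m ∨ p.2 ∈ S}) (q : Fin (r + 1) × Fin n) :
    slidingBar G m r S p q = (X ^ (q.1 : ℕ) * G p.1.2 q.2).coeff p.1.1 := by
  rw [slidingBar, Matrix.of_apply, coeff_X_pow_mul', ite_and]
  refine ite_congr rfl (fun _ => ?_) fun _ => rfl
  refine ite_eq_left_iff.2 fun hp => (coeff_eq_zero_of_natDegree_lt ?_).symm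
  exact (hdeg _ _).trans_lt (by lia)

/- Row `i` of the leading row coefficient matrix stands in block row `r + prescribedDegree m S i` of
`slidingBar`, where only the last block column is nonzero. -/
theorem linearIndependent_leadingRowCoeff (hm : 0 < m)
    (hdeg : ∀ i j, (G i j).natDegree ≤ prescribedDegree m S i)
    (hbar : LinearIndependent F (slidingBar G m r S).row) :
    LinearIndependent F (leadingRowCoeff G (prescribedDegree m S)).row := by
  have hdegm : ∀ i j, (G i j).natDegree ≤ m := fun i j =>
    (hdeg i j).trans (prescribedDegree_le m S i)
  let f : Fin k → {p : Fin (r + m + 1) × Fin k // (p.1 : ℕ) < r + m ∨ p.2 ∈ S} := fun i =>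
    ⟨(⟨r + prescribedDegree m S i, by have := prescribedDegree_le m S i; lia⟩, i), by
      by_cases hi : i ∈ S
      · exact .inr hi
      · exact .inl (by simp only [prescribedDegree, if_neg hi]; lia)⟩
  have hf : Function.Injective f := fun i i' h => congrArg (fun p => p.1.2) h
  refine Fintype.linearIndependent_iff.2 fun g hg =>
    Fintype.linearIndependent_iff.1 (hbar.comp f hf) g (funext fun q => ?_)
  have hentry : ∀ i, slidingBar G m r S (f i) q =
      if (q.1 : ℕ) = r then leadingRowCoeff G (prescribedDegree m S) i q.2 else 0 := fun i => by
    rw [slidingBar_apply hdegm, coeff_X_pow_mul', if_pos (by simp only [f]; lia)]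
    split_ifs with hq
    · simp [f, hq, leadingRowCoeff]
    · exact coeff_eq_zero_of_natDegree_lt ((hdeg _ _).trans_lt (by simp only [f]; lia))
  have hgq := congrFun hg q.2
  simp only [Finset.sum_apply, Pi.smul_apply, Matrix.row_apply, Function.comp_apply, hentry,
    Pi.zero_apply] at hgq ⊢
  split_ifs
  · exact hgq
  · simp

end RowDegrees

section LeftPrime

variable {G : Matrix (Fin k) (Fin n) F[X]} {m r : ℕ} {S : Finset (Fin k)}

theorem isLeftPrime_of_vecMul_aeval_eq_zero (K : Type*) [Field K] [IsAlgClosed K] [Algebra F K]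
    (h : ∀ (l : K) (w : Fin k → K), w ᵥ* G.map (aeval l) = 0 → w = 0) : IsLeftPrime G := by
  intro M G' hG
  by_contra hM
  rw [Matrix.isUnit_iff_isUnit_det, isUnit_iff_degree_eq_zero] at hM
  obtain ⟨l, hl⟩ := IsAlgClosed.exists_aeval_eq_zero K M.det hM
  rw [AlgHom.map_det] at hl
  obtain ⟨w, hw, hw0⟩ := Matrix.exists_vecMul_eq_zero_iff.2 hl
  refine hw (h l w ?_)
  rw [hG, Matrix.map_mul, ← Matrix.vecMul_vecMul]
  exact (congrArg (· ᵥ* G'.map (aeval l)) hw0).trans (Matrix.zero_vecMul _)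

theorem sum_coeff_smul_pow_mul {R A : Type*} [CommSemiring R] [Semiring A] [Algebra R A]
    {P : R[X]} {N : ℕ} (hP : P.natDegree < N) (x y : A) :
    ∑ p : Fin N, P.coeff p • (x ^ (p : ℕ) * y) = aeval x P * y := by
  rw [aeval_eq_sum_range' hP, Finset.sum_mul,
    Fin.sum_univ_eq_sum_range fun p => P.coeff p • (x ^ p * y)]
  simp only [smul_mul_assoc]

theorem sum_slidingBar_smul_pow_mul {A : Type*} [CommRing A] [Algebra F A] (hm : 0 < m)
    (hdeg : ∀ i j, (G i j).natDegree ≤ prescribedDegree m S i) (l : A) (w : Fin k → A)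
    (q : Fin (r + 1) × Fin n) :
    ∑ p, slidingBar G m r S p q • (l ^ (p.1.1 : ℕ) * w p.1.2) =
      l ^ (q.1 : ℕ) * (w ᵥ* G.map (aeval l)) q.2 := by
  have hdegm : ∀ i j, (G i j).natDegree ≤ m := fun i j =>
    (hdeg i j).trans (prescribedDegree_le m S i)
  have hshift : ∀ a, (X ^ (q.1 : ℕ) * G a q.2).natDegree ≤ r + prescribedDegree m S a := fun a =>
    natDegree_mul_le_of_le ((natDegree_X_pow_le _).trans (by lia)) (hdeg a q.2)
  let term : Fin (r + m + 1) × Fin k → A := fun p =>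
    (X ^ (q.1 : ℕ) * G p.2 q.2).coeff p.1 • (l ^ (p.1 : ℕ) * w p.2)
  have hterm : ∀ p, ¬ ((p.1 : ℕ) < r + m ∨ p.2 ∈ S) → term p = 0 := fun p hp => by
    rw [not_or] at hp
    have hlt : r + prescribedDegree m S p.2 < p.1 := by
      simp only [prescribedDegree, if_neg hp.2]
      lia
    simp only [term, coeff_eq_zero_of_natDegree_lt ((hshift p.2).trans_lt hlt), zero_smul]
  have hrow : ∀ a, ∑ p, term (p, a) = l ^ (q.1 : ℕ) * (w a * aeval l (G a q.2)) := fun a => by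
    have hlt : (X ^ (q.1 : ℕ) * G a q.2).natDegree < r + m + 1 :=
      (hshift a).trans_lt (by have := prescribedDegree_le m S a; lia)
    refine (sum_coeff_smul_pow_mul hlt l (w a)).trans ?_
    rw [map_mul, map_pow, aeval_X]
    ring
  calc ∑ p, slidingBar G m r S p q • (l ^ (p.1.1 : ℕ) * w p.1.2) = ∑ p, term p := by
        refine Fintype.sum_of_injective Subtype.val Subtype.val_injective _ term
          (fun p hp => hterm p fun h => hp ⟨⟨p, h⟩, rfl⟩) fun p => ?_
        rw [slidingBar_apply hdegm]
    _ = ∑ a, ∑ p, term (p, a) := by rw [Fintype.sum_prod_type, Finset.sum_comm]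
    _ = l ^ (q.1 : ℕ) * (w ᵥ* G.map (aeval l)) q.2 := by
        simp only [hrow, ← Finset.mul_sum, Matrix.vecMul, dotProduct, Matrix.map_apply]

theorem isLeftPrime_of_linearIndependent_slidingBar (hm : 0 < m)
    (hdeg : ∀ i j, (G i j).natDegree ≤ prescribedDegree m S i)
    (hbar : LinearIndependent F (slidingBar G m r S).row) : IsLeftPrime G := by
  refine isLeftPrime_of_vecMul_aeval_eq_zero (AlgebraicClosure F) fun l w hw => funext fun a => ?_
  have hzero := eq_zero_of_sum_smul_eq_zero hbar fun q => by
    rw [sum_slidingBar_smul_pow_mul hm hdeg l w q, hw, Pi.zero_apply, mul_zero]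
  simpa using congrFun hzero ⟨(0, a), .inl (by simp only [Fin.val_zero]; lia)⟩

end LeftPrime

end ConvCode

theorem mainTheorem6_general {F : Type*} [Field F] {n k δ m : ℕ} (hk : 0 < k) (hkn : k < n)
    (G : Matrix (Fin k) (Fin n) F[X]) (hm : 0 < m) (hdeg : ∀ i j, (G i j).natDegree ≤ m)
    (S : Finset (Fin k)) (hδ : δ = k * (m - 1) + S.card)
    (hSc : ∀ i, i ∉ S → ∀ j, (G i j).coeff m = 0)
    (hminors : ConvCode.MinorCriterion G (δ / k + δ / (n - k)))
    (r : ℕ) (hbar : LinearIndependent F (ConvCode.slidingBar G m r S).row) :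
    ∃ C : Submodule F[X] (Fin n → F[X]),
      ConvCode.IsConvolutionalCode C k δ ∧
      ConvCode.IsGeneratorMatrix C G ∧
      ConvCode.IsNoncatastrophic C k ∧
      ConvCode.IsMDP C k δ := by
  have : NeZero k := .of_pos hk
  have hdegS := ConvCode.natDegree_le_prescribedDegree hdeg hSc
  have hmax := ConvCode.isGreatest_natDegree_det_submatrix hdegS
    (ConvCode.linearIndependent_leadingRowCoeff hm hdegS hbar)
  rw [ConvCode.sum_prescribedDegree hm, ← hδ] at hmax
  obtain ⟨t, _, hdet, _⟩ := hmax.1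
  have hrows := ConvCode.linearIndependent_row_of_det_submatrix_ne_zero hdet
  have hgen : ConvCode.IsGeneratorMatrix (Submodule.span F[X] (Set.range G.row)) G := ⟨hrows, rfl⟩
  have hrank : Module.finrank F[X] (Submodule.span F[X] (Set.range G.row)) = k := by
    rw [finrank_span_eq_card hrows, Fintype.card_fin]
  have hprime := ConvCode.isLeftPrime_of_linearIndependent_slidingBar hm hdegS hbar
  exact ⟨_, ⟨hrank, G, hgen, hmax⟩, hgen, ⟨G, hgen, hprime⟩,
    fun j hj => hminors.columnDistance_eq hkn.le hj⟩

theorem mainTheorem6 {F : Type*} [Field F] [Finite F] (n k δ m L : ℕ)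
    (hk : 0 < k) (hkn : k < n) (hkδ : ¬ k ∣ δ)
    (hm : m = δ / k + 1) (hL : L = δ / (n - k) + m - 1)
    (G : Matrix (Fin k) (Fin n) F[X])
    (hdeg : ∀ i j, (G i j).natDegree ≤ m)
    (hred : ConvCode.IsRowReduced G)
    (hminors : ConvCode.MinorCriterion G L)
    (r : ℕ) (S : Finset (Fin k)) (hS : S.card = δ - k * (δ / k))
    (hSc : ∀ i, i ∉ S → ∀ j, (G i j).coeff m = 0)
    (hbar : LinearIndependent F (ConvCode.slidingBar G m r S).row) :
    ∃ C : Submodule F[X] (Fin n → F[X]),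
      ConvCode.IsConvolutionalCode C k δ ∧
      ConvCode.IsGeneratorMatrix C G ∧
      ConvCode.IsNoncatastrophic C k ∧
      ConvCode.IsMDP C k δ := by
  refine mainTheorem6_general hk hkn G (by lia) hdeg S ?_ hSc ?_ r hbar
  · rw [hS, hm, Nat.add_sub_cancel, Nat.add_sub_cancel' (Nat.mul_div_le δ k)]
  · rwa [show δ / k + δ / (n - k) = L by lia]
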